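/- Let $(F,g_F)$ be a connected smooth Riemannian manifold of dimension $n-1\ge 2$, let $I\subseteq\mathbb R$ be an open interval, and let $f:I\to(0,\infty)$ be smooth. Let $\overline M=I\times_f F$ be the corresponding Generalized Robertson--Walker (GRW) spacetime, i.e. the product manifold $I\times F$ with the Lorentzian metric $$\overline g=-dt^2+f(t)^2\,g_F ,$$ where $t$ is the coordinate on $I$ and $\partial_t=\partial/\partial t$. Let $M$ be a connected smooth manifold of dimension $k\ge 1$ and let $\psi:M\to\overline M$ be a spacelike immersion, i.e. a smooth immersion for which $g=\psi^*\overline g$ is a Riemannian metric on $M$. With $\overline\nabla$ the Levi-Civita connection of $\overline g$, let $\mathrm{II}(X,Y)=-(\overline\nabla_XY)^\perp$ be the second fundamental form of $\psi$ (note the sign convention), let $\overrightarrow H=\frac1k\operatorname{trace}_g(\mathrm{II})$ be the mean curvature vector field, and let $\tau=\pi_I\circ\psi:M\to I$ be the height function, where $\pi_I:I\times F\to I$ is the projection. (i) If $\overline g(\overrightarrow H,\partial_t)<0$ on all of $M$ and $f'\ge 0$ on $I$, then $\tau$ has no local minimum. The same conclusion holds if $\overline g(\overrightarrow H,\partial_t)\le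 0$ on $M$ and $f'>0$ on $I$. (ii) If $\overline g(\overrightarrow H,\partial_t)>0$ on all of $M$ and $f'\le 0$ on $I$, then $\tau$ has no local maximum. The same conclusion holds if $\overline g(\overrightarrow H,\partial_t)\ge 0$ on $M$ and $f'<0$ on $I$. Local extrema are understood in the non-strict sense. -/

import Mathlib

open scoped Manifold ContDiff

noncomputable section

namespace GRW

/-- The pullback `(u, v) ↦ B (A u) (A v)` of a bilinear form `B` under a linear map `A`. -/
def pullbackForm {V W : Type*} [NormedAddCommGroup V] [NormedSpace ℝ V]
    [NormedAddCommGroup W] [NormedSpace ℝ W] (B : V →L[ℝ] V →L[ℝ] ℝ) (A : W →L[ℝ] V) :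
    W →L[ℝ] W →L[ℝ] ℝ :=
  B.bilinearComp A A

section Ambient

variable {E : Type*} [NormedAddCommGroup E] [NormedSpace ℝ E]
  {H : Type*} [TopologicalSpace H] (I : ModelWithCorners ℝ E H)
  {N : Type*} [TopologicalSpace N] [ChartedSpace H N]

/-- A field of bilinear forms on the tangent spaces of `N`, i.e. a covariant 2-tensor field. -/
abbrev TwoTensor (N : Type*) [TopologicalSpace N] [ChartedSpace H N] :=
  ∀ x : N, TangentSpace I x →L[ℝ] TangentSpace I x →L[ℝ] ℝ

variable {I}

/-- The components `g_{ab}` of the metric `g` in the preferred chart around `q`, as a function of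
the coordinates `y`: the pullback of `g` under the inverse of the chart. -/
def chartMetric (g : TwoTensor I N) (q : N) (y : E) : E →L[ℝ] E →L[ℝ] ℝ :=
  pullbackForm (V := E) (W := E) (g ((extChartAt I q).symm y))
    (mfderiv 𝓘(ℝ, E) I (extChartAt I q).symm y)

/-- The Christoffel symbols of the first kind of `g` in the chart around `q`, at coordinates `y`:
the covector `w ↦ (1/2) (∂_u g(v, w) + ∂_v g(u, w) - ∂_w g(u, v))`. -/
def christoffelFirst (g : TwoTensor I N) (q : N) (y u v : E) : E →L[ℝ] ℝ :=
  (1 / 2 : ℝ) • (fderiv ℝ (chartMetric g q) y u v + fderiv ℝ (chartMetric g q) y v u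
    - ((fderiv ℝ (chartMetric g q) y).flip u).flip v)

/-- The Christoffel symbols `Γ(u, v)` (of the second kind) of the Levi-Civita connection of `g` in
the chart around `q`, at coordinates `y`: the first kind with its index raised by `g`, that is,
`g(Γ(u, v), w) = christoffelFirst g q y u v w` wherever `g` is nondegenerate. -/
def christoffel (g : TwoTensor I N) (q : N) (y u v : E) : E :=
  (chartMetric g q y).inverse (christoffelFirst g q y u v)

end Ambient

section Submanifold

variable {E : Type*} [NormedAddCommGroup E] [NormedSpace ℝ E]
  {H : Type*} [TopologicalSpace H] {I : ModelWithCorners ℝ E H}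
  {N : Type*} [TopologicalSpace N] [ChartedSpace H N]
  {M : Type*} [TopologicalSpace M]

/-- The covariant derivative at `p`, in the direction `v ∈ T_p M`, of a vector field `V` along
`ψ : M → N`, for the Levi-Civita connection of the metric `g` on `N`. In the chart around `ψ p` it
is `dV^a(v) + Γ^a_{bc} (dψ v)^b V^c`. -/
def covDerivAlong {k : ℕ} [ChartedSpace (EuclideanSpace ℝ (Fin k)) M]
    (g : TwoTensor I N) (ψ : M → N) (V : ∀ p : M, TangentSpace I (ψ p))
    (p : M) (v : TangentSpace (𝓡 k) p) : TangentSpace I (ψ p) :=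
  let φ : N → E := extChartAt I (ψ p)
  let Vc : M → E := fun p' => mfderiv I 𝓘(ℝ, E) φ (ψ p') (V p')
  let dV : E := mfderiv (𝓡 k) 𝓘(ℝ, E) Vc p v
  let u : E := mfderiv I 𝓘(ℝ, E) φ (ψ p) (mfderiv (𝓡 k) I ψ p v)
  -- the chart identifies `T_{ψ p} N` with `E`; transport the components back
  (mfderiv I 𝓘(ℝ, E) φ (ψ p)).inverse (dV + christoffel g (ψ p) (φ (ψ p)) u (Vc p))

/-- The metric induced on `M` by `ψ` from the metric `g` on `N`. -/
def inducedMetric (k : ℕ) [ChartedSpace (EuclideanSpace ℝ (Fin k)) M]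
    (g : TwoTensor I N) (ψ : M → N) : TwoTensor (𝓡 k) M :=
  fun p => pullbackForm (V := E) (W := EuclideanSpace ℝ (Fin k)) (g (ψ p)) (mfderiv (𝓡 k) I ψ p)

/-- The tangential component `w^⊤ ∈ T_p M` of a vector `w ∈ T_{ψ p} N`: the vector with
`(ψ^* g)(w^⊤, v) = g(w, dψ v)` for all `v ∈ T_p M`. -/
def tangentPart (k : ℕ) [ChartedSpace (EuclideanSpace ℝ (Fin k)) M]
    (g : TwoTensor I N) (ψ : M → N) (p : M) (w : TangentSpace I (ψ p)) :
    TangentSpace (𝓡 k) p :=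
  (inducedMetric k g ψ p).inverse ((g (ψ p) w).comp (mfderiv (𝓡 k) I ψ p))

/-- The normal component `w^⊥ = w - dψ(w^⊤)` of a vector `w ∈ T_{ψ p} N`. -/
def normalPart (k : ℕ) [ChartedSpace (EuclideanSpace ℝ (Fin k)) M]
    (g : TwoTensor I N) (ψ : M → N) (p : M) (w : TangentSpace I (ψ p)) :
    TangentSpace I (ψ p) :=
  w - mfderiv (𝓡 k) I ψ p (tangentPart k g ψ p w)

/-- The second fundamental form, with the sign convention of General Relativity:
`II(X, Y) = -(∇_X Y)^⊥` for vector fields `X`, `Y` on `M`, where `∇` is the Levi-Civita connection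
of the ambient metric `g`. -/
def secondFundamentalForm {k : ℕ} [ChartedSpace (EuclideanSpace ℝ (Fin k)) M]
    (g : TwoTensor I N) (ψ : M → N)
    (X Y : ∀ p : M, TangentSpace (𝓡 k) p) (p : M) : TangentSpace I (ψ p) :=
  -normalPart k g ψ p (covDerivAlong g ψ (fun p' => mfderiv (𝓡 k) I ψ p' (Y p')) p (X p))

/-- The `i`-th coordinate vector field of the preferred chart of `M` around `p₀` (used only on
the domain of that chart). -/
def coordField {k : ℕ} [ChartedSpace (EuclideanSpace ℝ (Fin k)) M]
    (p₀ : M) (i : Fin k) (p : M) : TangentSpace (𝓡 k) p :=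
  mfderiv 𝓘(ℝ, EuclideanSpace ℝ (Fin k)) (𝓡 k) (extChartAt (𝓡 k) p₀).symm
    (extChartAt (𝓡 k) p₀ p) (EuclideanSpace.single i (1 : ℝ))

/-- The Gram matrix `g_{ij}` of the induced metric at `p`, in the coordinate frame around `p`. -/
def gram (k : ℕ) [ChartedSpace (EuclideanSpace ℝ (Fin k)) M]
    (g : TwoTensor I N) (ψ : M → N) (p : M) : Matrix (Fin k) (Fin k) ℝ :=
  Matrix.of fun i j => inducedMetric k g ψ p (coordField p i p) (coordField p j p)

/-- The mean curvature vector `(1/k) trace II`, the trace being taken with respect to the induced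
metric: `(1/k) ∑_{i,j} g^{ij} II(∂_i, ∂_j)`. -/
def meanCurvature (k : ℕ) [ChartedSpace (EuclideanSpace ℝ (Fin k)) M]
    (g : TwoTensor I N) (ψ : M → N) (p : M) : TangentSpace I (ψ p) :=
  (1 / (k : ℝ)) • ∑ i : Fin k, ∑ j : Fin k,
    (gram k g ψ p)⁻¹ i j • secondFundamentalForm g ψ (coordField p i) (coordField p j) p

end Submanifold

section Spacetime

variable {m : ℕ} {F : Type*} [TopologicalSpace F] [ChartedSpace (EuclideanSpace ℝ (Fin m)) F]
  [IsManifold (𝓡 m) ∞ F]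

/-- The model of the product manifold `ℝ × F`. The spacetime `J ×_f F`, `J` an open interval, is
the open subset `J × F` of `ℝ × F`. -/
abbrev model (m : ℕ) := (𝓘(ℝ, ℝ)).prod (𝓡 m)

/-- The Lorentzian warped product metric `-dt² + f(t)² g_F`. -/
def metric (f : ℝ → ℝ)
    (gF : Bundle.ContMDiffRiemannianMetric (𝓡 m) ∞ (EuclideanSpace ℝ (Fin m))
      (fun x : F => TangentSpace (𝓡 m) x)) : TwoTensor (model m) (ℝ × F) :=
  fun z =>
    let dt : TangentSpace (model m) z →L[ℝ] ℝ :=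
      mfderiv (model m) 𝓘(ℝ, ℝ) (Prod.fst : ℝ × F → ℝ) z
    let dF : TangentSpace (model m) z →L[ℝ] TangentSpace (𝓡 m) z.2 :=
      mfderiv (model m) (𝓡 m) (Prod.snd : ℝ × F → F) z
    (f z.1) ^ 2 • pullbackForm (V := EuclideanSpace ℝ (Fin m))
        (W := ℝ × EuclideanSpace ℝ (Fin m)) (gF.inner z.2) dF
      - pullbackForm (V := ℝ) (W := ℝ × EuclideanSpace ℝ (Fin m)) (ContinuousLinearMap.mul ℝ ℝ) dt

/-- The coordinate vector field `∂_t` on `ℝ × F`. -/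
def partialT (z : ℝ × F) : TangentSpace (model m) z :=
  ((1 : ℝ), (0 : EuclideanSpace ℝ (Fin m)))

/-- `ψ` is a smooth immersion of `M` into `J ×_f F ⊆ ℝ × F` whose induced metric is Riemannian. -/
structure IsSpacelikeImmersion (k : ℕ) {M : Type*} [TopologicalSpace M]
    [ChartedSpace (EuclideanSpace ℝ (Fin k)) M] (J : Set ℝ) (f : ℝ → ℝ)
    (gF : Bundle.ContMDiffRiemannianMetric (𝓡 m) ∞ (EuclideanSpace ℝ (Fin m))
      (fun x : F => TangentSpace (𝓡 m) x)) (ψ : M → ℝ × F) : Prop where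
  mem : ∀ p, (ψ p).1 ∈ J
  contMDiff : ContMDiff (𝓡 k) (model m) ∞ ψ
  injective : ∀ p, Function.Injective (mfderiv (𝓡 k) (model m) ψ p)
  posDef : ∀ (p : M) (v : TangentSpace (𝓡 k) p), v ≠ 0 →
    0 < inducedMetric k (metric f gF) ψ p v v

/-- The height function `τ = π_J ∘ ψ`. -/
def height {M : Type*} (ψ : M → ℝ × F) : M → ℝ := fun p => (ψ p).1

end Spacetime

end GRW

end

/-! Pairing with `∂_t` reads off minus the time component, so `g(II(∂_i, ∂_j), ∂_t)` is the time
component of the normal part of `∇_{∂_i} ∂_j`. At a critical point of `τ` every vector `dψ(v)` has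
zero time component, so projecting to the normal space changes nothing there. In the chart, that
component is `∂_i ∂_j τ + Γ^t(∂_i ψ, ∂_j ψ)`. For the warped product `Γ^t(u, v) = f f' g_F(u, v)`,
which on vectors tangent to the fiber is `(f'/f) g(u, v)`. Tracing with the induced metric gives, at
critical points, `g(H, ∂_t) = (1/k) g^{ij} ∂_i ∂_j τ + f'/f`.

At a local minimum the Hessian is positive semidefinite, and its contraction with the positive
definite `g^{ij}` is nonnegative; hence `g(H, ∂_t) ≥ f'/f`, with the reverse inequality at a local
maximum. Each of the four sign hypotheses contradicts one of these bounds. The carrying lemmas are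
`christoffel_metric_fst`, `covDerivAlong_coordField`, `metric_meanCurvature_partialT` and
`sum_inv_mul_nonneg`. -/

open scoped Manifold ContDiff

noncomputable section

namespace GRW

/-! ### Second-order condition at a local minimum -/

section SecondDerivative

variable {E : Type*} [NormedAddCommGroup E] [NormedSpace ℝ E] {T : E → ℝ} {x : E}

/-- The second derivative is nonnegative on the diagonal at a local minimum. -/
theorem fderiv_fderiv_nonneg_of_isLocalMin (hT : ContDiffAt ℝ 2 T x) (h : IsLocalMin T x) (v : E) :
    0 ≤ fderiv ℝ (fderiv ℝ T) x v v := by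
  set c : ℝ → E := fun s => x + s • v with hc
  have hc0 : c 0 = x := by simp [hc]
  have hcd : ∀ s, HasDerivAt c v s := fun s => by
    simpa [hc] using ((hasDerivAt_id s).smul_const v).const_add x
  have hct : Filter.Tendsto c (nhds 0) (nhds x) := by
    have := (hcd 0).continuousAt.tendsto
    rwa [hc0] at this
  have hT1 : ∀ᶠ y in nhds x, DifferentiableAt ℝ T y := by
    have h1 := hT.eventually (by simp)
    filter_upwards [h1] with y hy using hy.differentiableAt (by simp)
  have hd1 : deriv (T ∘ c) =ᶠ[nhds 0] fun s => fderiv ℝ T (c s) v := by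
    filter_upwards [hct.eventually hT1] with s hs
    exact (hs.hasFDerivAt.comp_hasDerivAt s (hcd s)).deriv
  have hT2 : HasFDerivAt (fderiv ℝ T) (fderiv ℝ (fderiv ℝ T) x) x :=
    ((hT.fderiv_right (m := 1) (by norm_num)).differentiableAt (by simp)).hasFDerivAt
  have hd2 : deriv (deriv (T ∘ c)) 0 = fderiv ℝ (fderiv ℝ T) x v v := by
    rw [hd1.deriv_eq]
    have h1 : HasDerivAt (fun s => fderiv ℝ T (c s)) (fderiv ℝ (fderiv ℝ T) x v) 0 :=
      HasFDerivAt.comp_hasDerivAt (0 : ℝ) (by rwa [hc0]) (hcd 0)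
    have := h1.clm_apply (hasDerivAt_const (0 : ℝ) v)
    simpa using this.deriv
  have hmin : IsLocalMin (T ∘ c) 0 := by
    have := hct.eventually h
    simpa [IsLocalMin, IsMinFilter, hc0] using this
  -- A negative second derivative would make 0 a local maximum of `T ∘ c` as well, so `T ∘ c` would
  -- be locally constant and its second derivative zero.
  by_contra! hneg
  have hmax : IsLocalMax (T ∘ c) 0 := isLocalMax_of_deriv_deriv_neg (by rwa [hd2])
    hmin.deriv_eq_zero
    (ContinuousAt.comp (by rw [hc0]; exact hT.continuousAt) (hcd 0).continuousAt)
  have hconst : T ∘ c =ᶠ[nhds 0] fun _ => (T ∘ c) 0 := by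
    filter_upwards [hmin, hmax] with s h1 h2 using le_antisymm h2 h1
  have h0 : deriv (T ∘ c) =ᶠ[nhds 0] fun _ => 0 := by
    simpa using hconst.deriv
  have := h0.deriv_eq
  rw [hd2] at this
  simp only [deriv_const] at this
  linarith

end SecondDerivative

/-! ### Traces against the inverse of a positive definite matrix -/

open scoped MatrixOrder Matrix.Norms.L2Operator in
/-- The contraction of a positive semidefinite matrix with the inverse of a positive definite one is
nonnegative. -/
theorem sum_inv_mul_nonneg {k : ℕ} {G A : Matrix (Fin k) (Fin k) ℝ} (hG : G.PosDef)
    (hA : A.PosSemidef) : 0 ≤ ∑ i, ∑ j, G⁻¹ i j * A i j := by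
  have hG' : (G⁻¹).PosSemidef := hG.inv.posSemidef
  -- With `G⁻¹ = B* B`, cyclicity turns the trace of `G⁻¹ A` into that of `B A B*`, which is
  -- positive semidefinite.
  obtain ⟨B, hB⟩ := CStarAlgebra.nonneg_iff_eq_star_mul_self.mp hG'.nonneg
  have h1 : ∑ i, ∑ j, G⁻¹ i j * A i j = (G⁻¹ * A).trace := by
    simp only [Matrix.trace, Matrix.diag, Matrix.mul_apply]
    refine Finset.sum_congr rfl fun i _ => Finset.sum_congr rfl fun j _ => ?_
    -- The entrywise sum is the trace of `G⁻¹ Aᵀ`; symmetry removes the transpose.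
    rw [← hA.isHermitian.apply i j]; simp
  rw [h1, hB, Matrix.star_eq_conjTranspose, Matrix.mul_assoc, Matrix.trace_mul_comm]
  exact (hA.mul_mul_conjTranspose_same B).trace_nonneg

theorem sum_inv_mul_self {k : ℕ} {G : Matrix (Fin k) (Fin k) ℝ} (hG : G.PosDef) :
    ∑ i, ∑ j, G⁻¹ i j * G i j = k := by
  have h1 : ∑ i, ∑ j, G⁻¹ i j * G i j = (G⁻¹ * G).trace := by
    simp only [Matrix.trace, Matrix.diag, Matrix.mul_apply]
    refine Finset.sum_congr rfl fun i _ => Finset.sum_congr rfl fun j _ => ?_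
    rw [← hG.isHermitian.apply i j]; simp
  rw [h1, Matrix.nonsing_inv_mul _ (by simpa using hG.det_pos.ne')]
  simp

/-! ### Matrices of bilinear forms -/

section FormMatrix

variable {k : ℕ}

/-- The matrix of a bilinear form in the standard basis. -/
def formMatrix (B : EuclideanSpace ℝ (Fin k) →L[ℝ] EuclideanSpace ℝ (Fin k) →L[ℝ] ℝ) :
    Matrix (Fin k) (Fin k) ℝ :=
  Matrix.of fun i j => B (EuclideanSpace.single i 1) (EuclideanSpace.single j 1)

theorem dotProduct_formMatrix
    (B : EuclideanSpace ℝ (Fin k) →L[ℝ] EuclideanSpace ℝ (Fin k) →L[ℝ] ℝ) (x : Fin k → ℝ) :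
    x ⬝ᵥ (formMatrix B).mulVec x = B (WithLp.toLp 2 x) (WithLp.toLp 2 x) := by
  have hx : WithLp.toLp 2 x = ∑ i, x i • EuclideanSpace.single i (1 : ℝ) := by
    ext j
    simp [Finset.sum_apply, Pi.single_apply]
  rw [hx]
  simp only [map_sum, map_smul, sum_apply, smul_apply, smul_eq_mul, dotProduct, Matrix.mulVec,
    formMatrix, Matrix.of_apply, Finset.mul_sum]
  rw [Finset.sum_comm]
  refine Finset.sum_congr rfl fun i _ => Finset.sum_congr rfl fun j _ => ?_
  ring

variable {B : EuclideanSpace ℝ (Fin k) →L[ℝ] EuclideanSpace ℝ (Fin k) →L[ℝ] ℝ}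

theorem isHermitian_formMatrix (hB : ∀ v w, B v w = B w v) : (formMatrix B).IsHermitian := by
  ext i j
  exact hB _ _

theorem posSemidef_formMatrix (hB : ∀ v w, B v w = B w v) (h : ∀ v, 0 ≤ B v v) :
    (formMatrix B).PosSemidef :=
  .of_dotProduct_mulVec_nonneg (isHermitian_formMatrix hB) fun x => by
    rw [star_trivial, dotProduct_formMatrix]
    exact h _

theorem posDef_formMatrix (hB : ∀ v w, B v w = B w v) (h : ∀ v, v ≠ 0 → 0 < B v v) :
    (formMatrix B).PosDef :=
  .of_dotProduct_mulVec_pos (isHermitian_formMatrix hB) fun x hx => by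
    rw [star_trivial, dotProduct_formMatrix]
    exact h _ (by simpa using hx)

end FormMatrix

/-! ### The warped metric in product charts -/

section Spacetime

variable {m : ℕ} {F : Type*} [TopologicalSpace F] [ChartedSpace (EuclideanSpace ℝ (Fin m)) F]
  [IsManifold (𝓡 m) ∞ F]
  (f : ℝ → ℝ) (gF : Bundle.ContMDiffRiemannianMetric (𝓡 m) ∞ (EuclideanSpace ℝ (Fin m))
      (fun x : F => TangentSpace (𝓡 m) x))

theorem metric_apply (z : ℝ × F) (u v : ℝ × EuclideanSpace ℝ (Fin m)) :
    (metric f gF z : (ℝ × EuclideanSpace ℝ (Fin m)) →L[ℝ] (ℝ × EuclideanSpace ℝ (Fin m)) →L[ℝ] ℝ)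
      u v = f z.1 ^ 2 * (gF.inner z.2 : EuclideanSpace ℝ (Fin m) →L[ℝ] EuclideanSpace ℝ (Fin m)
        →L[ℝ] ℝ) u.2 v.2 - u.1 * v.1 := by
  simp only [metric, pullbackForm, mfderiv_fst, mfderiv_snd]
  rfl

theorem metric_apply_time (z : ℝ × F) (u : ℝ × EuclideanSpace ℝ (Fin m)) :
    (metric f gF z : (ℝ × EuclideanSpace ℝ (Fin m)) →L[ℝ] (ℝ × EuclideanSpace ℝ (Fin m)) →L[ℝ] ℝ)
      u (1, 0) = -u.1 := by
  have h : (gF.inner z.2 : EuclideanSpace ℝ (Fin m) →L[ℝ] EuclideanSpace ℝ (Fin m) →L[ℝ] ℝ)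
      u.2 0 = 0 := map_zero (M := EuclideanSpace ℝ (Fin m)) (N := ℝ) _
  refine (metric_apply f gF z u (1, 0)).trans ?_
  change f z.1 ^ 2 * (gF.inner z.2 : EuclideanSpace ℝ (Fin m) →L[ℝ] EuclideanSpace ℝ (Fin m)
    →L[ℝ] ℝ) u.2 0 - u.1 * 1 = -u.1
  rw [h]
  ring

theorem mfderiv_extChartAt_symm_model (q : ℝ × F) {y : ℝ × EuclideanSpace ℝ (Fin m)}
    (hy : y.2 ∈ (extChartAt (𝓡 m) q.2).target) :
    (mfderiv 𝓘(ℝ, ℝ × EuclideanSpace ℝ (Fin m)) (model m) (extChartAt (model m) q).symm y :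
      (ℝ × EuclideanSpace ℝ (Fin m)) →L[ℝ] (ℝ × EuclideanSpace ℝ (Fin m))) =
    (ContinuousLinearMap.id ℝ ℝ).prodMap
      (mfderiv 𝓘(ℝ, EuclideanSpace ℝ (Fin m)) (𝓡 m) (extChartAt (𝓡 m) q.2).symm y.2 :
        EuclideanSpace ℝ (Fin m) →L[ℝ] EuclideanSpace ℝ (Fin m)) := by
  have h1 : IsManifold (𝓡 m) 1 F := IsManifold.of_le (n := ∞) (by simp)
  have h := mdifferentiableWithinAt_extChartAt_symm (I := 𝓡 m) hy
  rw [ModelWithCorners.range_eq_univ, mdifferentiableWithinAt_univ] at h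
  have h2 := h.hasMFDerivAt.comp y
    (ContinuousLinearMap.snd ℝ ℝ (EuclideanSpace ℝ (Fin m))).hasMFDerivAt
  have h3 := (ContinuousLinearMap.fst ℝ ℝ (EuclideanSpace ℝ (Fin m))).hasMFDerivAt (x := y)
  have e : ⇑(extChartAt (model m) q).symm = Prod.map id (extChartAt (𝓡 m) q.2).symm := by
    rw [extChartAt_prod]; rfl
  rw [e]
  exact (h3.prodMk h2).mfderiv

/-- The product chart is the identity on the time factor, so time enters the components only through
`f ^ 2`. The formula holds throughout the chart target, hence may be differentiated. -/
theorem chartMetric_metric (q : ℝ × F) {y : ℝ × EuclideanSpace ℝ (Fin m)}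
    (hy : y.2 ∈ (extChartAt (𝓡 m) q.2).target) (u v : ℝ × EuclideanSpace ℝ (Fin m)) :
    chartMetric (metric f gF) q y u v =
      f y.1 ^ 2 * chartMetric (I := 𝓡 m) gF.inner q.2 y.2 u.2 v.2 - u.1 * v.1 := by
  have := mfderiv_extChartAt_symm_model q hy
  simp only [chartMetric, pullbackForm]
  rw [this]
  refine (metric_apply f gF _ _ _).trans ?_
  rfl

/-- Smoothness of `gF` is a statement about a bundle section. Evaluating it on two smooth frame
fields gives smooth scalar functions, and these are the chart components because the trivialization
of the tangent bundle is the derivative of the chart. -/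
theorem contDiffOn_chartMetric_inner (x : F) :
    ContDiffOn ℝ 1 (chartMetric (I := 𝓡 m) gF.inner x) (extChartAt (𝓡 m) x).target := by
  have h1 : IsManifold (𝓡 m) 1 F := IsManifold.of_le (n := ∞) (by simp)
  suffices h : ∀ y ∈ (extChartAt (𝓡 m) x).target, ∀ w w', ContDiffAt ℝ 1
      (fun y => chartMetric (I := 𝓡 m) gF.inner x y w w') y from
    contDiffOn_clm_apply.2 fun w => contDiffOn_clm_apply.2 fun w' => fun y hy =>
      (h y hy w w').contDiffWithinAt
  intro y hy w w'
  have hys : (extChartAt (𝓡 m) x).symm y ∈ (chartAt (EuclideanSpace ℝ (Fin m)) x).source := by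
    simpa using (extChartAt (𝓡 m) x).map_target hy
  -- The section that is constantly `w` in the trivialization around `x` is smooth.
  have hs : ∀ w : EuclideanSpace ℝ (Fin m), ContMDiffAt (𝓡 m) ((𝓡 m).prod (𝓡 m)) ∞
      (fun b : F => (Bundle.TotalSpace.mk' (EuclideanSpace ℝ (Fin m)) b
        ((trivializationAt (EuclideanSpace ℝ (Fin m)) (TangentSpace (𝓡 m)) x).symmL ℝ b w) :
          TangentBundle (𝓡 m) F)) ((extChartAt (𝓡 m) x).symm y) := by
    intro w
    set e := trivializationAt (EuclideanSpace ℝ (Fin m)) (TangentSpace (𝓡 m) (M := F)) x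
    have : ContMDiffOn (𝓡 m) ((𝓡 m).prod (𝓡 m)) ∞
      (fun b : F => (Bundle.TotalSpace.mk' (EuclideanSpace ℝ (Fin m)) b
        (e.symmL ℝ b w) : TangentBundle (𝓡 m) F)) e.baseSet := by
      rw [e.contMDiffOn_section_baseSet_iff]
      apply (contMDiffOn_const (c := w)).congr
      intro y hy
      simp [hy, e.apply_mk_symm]
    exact this.contMDiffAt (e.open_baseSet.mem_nhds (by simpa [e] using hys))
  have h3 := gF.contMDiff.contMDiffAt.clm_bundle_apply₂ (hs w) (hs w')
  rw [Bundle.contMDiffAt_section] at h3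
  have h4 : ContMDiffAt 𝓘(ℝ, EuclideanSpace ℝ (Fin m)) (𝓡 m) ∞ (extChartAt (𝓡 m) x).symm y :=
    (contMDiffOn_extChartAt_symm x).contMDiffAt (extChartAt_target_mem_nhds' hy)
  have h5 := (h3.comp y h4).contDiffAt.of_le (m := 1) (by simp)
  refine h5.congr_of_eventuallyEq ?_
  filter_upwards [extChartAt_target_mem_nhds' hy] with z hz
  have hzs : (extChartAt (𝓡 m) x).symm z ∈ (chartAt (EuclideanSpace ℝ (Fin m)) x).source := by
    simpa using (extChartAt (𝓡 m) x).map_target hz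
  have h6 := TangentBundle.symmL_trivializationAt (I := 𝓡 m) (𝕜 := ℝ) hzs
  rw [ModelWithCorners.range_eq_univ, mfderivWithin_univ, (extChartAt (𝓡 m) x).right_inv hz] at h6
  simp only [chartMetric, pullbackForm, Function.comp_def]
  rw [h6]
  rfl

end Spacetime

/-! ### Nondegeneracy, and charts at their base point -/

/-- A bilinear form on a finite-dimensional space without left kernel is invertible. -/
theorem isInvertible_of_injective_form {V : Type*} [NormedAddCommGroup V] [NormedSpace ℝ V]
    [FiniteDimensional ℝ V] (B : V →L[ℝ] V →L[ℝ] ℝ) (hB : Function.Injective B) :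
    B.IsInvertible := by
  have hfr : Module.finrank ℝ V = Module.finrank ℝ (V →L[ℝ] ℝ) := by
    rw [← (LinearMap.toContinuousLinearMap (𝕜 := ℝ) (E := V) (F' := ℝ)).finrank_eq]
    exact (Subspace.dual_finrank_eq (K := ℝ) (V := V)).symm
  let e : V ≃ₗ[ℝ] (V →L[ℝ] ℝ) := LinearEquiv.ofInjectiveOfFinrankEq (B : V →ₗ[ℝ] _) hB hfr
  exact ⟨e.toContinuousLinearEquiv, by ext; rfl⟩

section Chart

variable {E : Type*} [NormedAddCommGroup E] [NormedSpace ℝ E]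
  {H : Type*} [TopologicalSpace H] {I : ModelWithCorners ℝ E H} [I.Boundaryless]
  {N : Type*} [TopologicalSpace N] [ChartedSpace H N] [IsManifold I 1 N]

/-- The tangent space at `q` is identified with `E` by the preferred chart at `q` itself. -/
theorem mfderiv_extChartAt_symm_self (q : N) :
    (mfderiv 𝓘(ℝ, E) I (extChartAt I q).symm (extChartAt I q q) : E →L[ℝ] E) =
      ContinuousLinearMap.id ℝ E := by
  have := mfderivWithin_range_extChartAt_symm (I := I) (x := q)
  rwa [ModelWithCorners.range_eq_univ, mfderivWithin_univ] at this

theorem chartMetric_self (g : TwoTensor I N) (q : N) (u v : E) :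
    chartMetric g q (extChartAt I q q) u v = (g q : E →L[ℝ] E →L[ℝ] ℝ) u v := by
  rw [chartMetric, mfderiv_extChartAt_symm_self, extChartAt_to_inv]
  rfl

end Chart

/-! ### The time component of the Christoffel symbols -/

section Spacetime

variable {m : ℕ} {F : Type*} [TopologicalSpace F] [ChartedSpace (EuclideanSpace ℝ (Fin m)) F]

theorem extChartAt_model_fst (q z : ℝ × F) : (extChartAt (model m) q z).1 = z.1 := by
  rw [extChartAt_prod]; rfl

theorem extChartAt_model_snd (q z : ℝ × F) :
    (extChartAt (model m) q z).2 = extChartAt (𝓡 m) q.2 z.2 := by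
  rw [extChartAt_prod]; rfl

variable [IsManifold (𝓡 m) ∞ F]
  {f : ℝ → ℝ} {gF : Bundle.ContMDiffRiemannianMetric (𝓡 m) ∞ (EuclideanSpace ℝ (Fin m))
      (fun x : F => TangentSpace (𝓡 m) x)}
  {J : Set ℝ}

/-- Needed because `christoffelFirst` takes `fderiv` of the form-valued map, which would be the
default value 0 without differentiability. -/
theorem differentiableAt_chartMetric_metric (hJ : IsOpen J) (hf : ContDiffOn ℝ ∞ f J)
    {q : ℝ × F} (hq : q.1 ∈ J) :
    DifferentiableAt ℝ (chartMetric (metric f gF) q) (extChartAt (model m) q q) := by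
  set U := J ×ˢ (extChartAt (𝓡 m) q.2).target with hU
  have hUo : IsOpen U := hJ.prod (isOpen_extChartAt_target q.2)
  have hmem : extChartAt (model m) q q ∈ U := by
    refine ⟨by rwa [extChartAt_model_fst], ?_⟩
    rw [extChartAt_model_snd]
    exact mem_extChartAt_target q.2
  have h : ContDiffOn ℝ 1 (chartMetric (metric f gF) q) U := by
    refine contDiffOn_clm_apply.2 fun u => contDiffOn_clm_apply.2 fun v => ?_
    have h1 : ContDiffOn ℝ 1 (fun y : ℝ × EuclideanSpace ℝ (Fin m) => f y.1) U :=
      (hf.of_le (by simp)).comp contDiffOn_fst fun y hy => hy.1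
    have h2 : ContDiffOn ℝ 1 (fun y : ℝ × EuclideanSpace ℝ (Fin m) =>
        chartMetric (I := 𝓡 m) gF.inner q.2 y.2) U :=
      (contDiffOn_chartMetric_inner gF q.2).comp contDiffOn_snd fun y hy => hy.2
    have h3 := ((h1.pow 2).mul ((h2.clm_apply (contDiffOn_const (c := u.2))).clm_apply
      (contDiffOn_const (c := v.2)))).sub (contDiffOn_const (c := u.1 * v.1))
    exact h3.congr fun y hy => chartMetric_metric f gF q hy.2 u v
  exact ((h _ hmem).contDiffAt (hUo.mem_nhds hmem)).differentiableAt (by simp)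

/-- If `u` is in the kernel, pairing with `∂_t` kills its time component; pairing with `u` itself
then kills its fiber component, as `gF` is positive definite. Invertibility keeps `inverse` in
`christoffel` from being the default 0. -/
theorem isInvertible_chartMetric_metric {q : ℝ × F} (hq : f q.1 ≠ 0) :
    (chartMetric (metric f gF) q (extChartAt (model m) q q)).IsInvertible := by
  have h1 : IsManifold (model m) 1 (ℝ × F) := IsManifold.of_le (n := ∞) (by simp)
  refine isInvertible_of_injective_form _ ((injective_iff_map_eq_zero _).2 fun u hu => ?_)
  have h : ∀ v : ℝ × EuclideanSpace ℝ (Fin m), f q.1 ^ 2 * (gF.inner q.2 :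
      EuclideanSpace ℝ (Fin m) →L[ℝ] EuclideanSpace ℝ (Fin m) →L[ℝ] ℝ) u.2 v.2 - u.1 * v.1 = 0 := by
    intro v
    rw [← metric_apply, ← chartMetric_self, hu]
    rfl
  have hu1 : u.1 = 0 := by
    have h2 := metric_apply_time f gF q u
    rw [← chartMetric_self, hu] at h2
    simpa using h2.symm
  have hu2 : u.2 = 0 := by
    by_contra hne
    have := gF.pos q.2 u.2 hne
    have h2 := h u
    rw [hu1, zero_mul, sub_zero] at h2
    rcases mul_eq_zero.1 h2 with h3 | h3
    · exact hq (by simpa using h3)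
    · exact this.ne' h3
  exact Prod.ext hu1 hu2

/-- Pairing with `∂_t` gives `-Γ^t = (1/2) (∂_u g(v, ∂_t) + ∂_v g(u, ∂_t) - ∂_t g(u, v))`. The first
two terms vanish, and the third comes from differentiating `f ^ 2`. -/
theorem christoffel_metric_fst (hJ : IsOpen J) (hf : ContDiffOn ℝ ∞ f J)
    {q : ℝ × F} (hq : q.1 ∈ J) (hfq : f q.1 ≠ 0) (u v : ℝ × EuclideanSpace ℝ (Fin m)) :
    (christoffel (metric f gF) q (extChartAt (model m) q q) u v).1 =
      f q.1 * deriv f q.1 * (gF.inner q.2 :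
        EuclideanSpace ℝ (Fin m) →L[ℝ] EuclideanSpace ℝ (Fin m) →L[ℝ] ℝ) u.2 v.2 := by
  have h1 : IsManifold (model m) 1 (ℝ × F) := IsManifold.of_le (n := ∞) (by simp)
  have h1' : IsManifold (𝓡 m) 1 F := IsManifold.of_le (n := ∞) (by simp)
  set y₀ := extChartAt (model m) q q with hy₀
  have hy1 : y₀.1 = q.1 := extChartAt_model_fst q q
  have hy2 : y₀.2 = extChartAt (𝓡 m) q.2 q.2 := extChartAt_model_snd q q
  have hmem : ∀ᶠ y in nhds y₀, y.2 ∈ (extChartAt (𝓡 m) q.2).target :=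
    continuous_snd.continuousAt.eventually
      (by rw [hy2]; exact extChartAt_target_mem_nhds q.2)
  have hd := differentiableAt_chartMetric_metric (gF := gF) hJ hf hq
  have happ : ∀ a b, HasFDerivAt (fun y => chartMetric (metric f gF) q y a b)
      (((fderiv ℝ (chartMetric (metric f gF) q) y₀).flip a).flip b) y₀ := by
    intro a b
    have := (hd.hasFDerivAt.clm_apply (hasFDerivAt_const a y₀)).clm_apply (hasFDerivAt_const b y₀)
    refine this.congr_fderiv (ContinuousLinearMap.ext fun c => ?_)
    simp [-extChartAt, y₀]
  -- the metric coefficients `g(a, ∂_t)` are constant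
  have hconst : ∀ a c, fderiv ℝ (chartMetric (metric f gF) q) y₀ c a (1, 0) = 0 := by
    intro a c
    have h2 : HasFDerivAt (fun y => chartMetric (metric f gF) q y a (1, 0))
        (0 : _ →L[ℝ] ℝ) y₀ := by
      refine (hasFDerivAt_const (-a.1) y₀).congr_of_eventuallyEq ?_
      filter_upwards [hmem] with y hy
      rw [chartMetric_metric f gF q hy]
      simp
    have := (happ a (1, 0)).unique h2
    simpa using congrArg (fun L => L c) this
  have hfd : HasDerivAt f (deriv f q.1) q.1 :=
    ((hf.contDiffAt (hJ.mem_nhds hq)).differentiableAt (by simp)).hasDerivAt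
  have htime : fderiv ℝ (chartMetric (metric f gF) q) y₀ (1, 0) u v =
      2 * f q.1 * deriv f q.1 * (gF.inner q.2 :
        EuclideanSpace ℝ (Fin m) →L[ℝ] EuclideanSpace ℝ (Fin m) →L[ℝ] ℝ) u.2 v.2 := by
    -- On the time line through the base point only the factor `f ^ 2` varies.
    have hline : HasDerivAt (fun s : ℝ => ((s, y₀.2) : ℝ × EuclideanSpace ℝ (Fin m)))
        (1, 0) q.1 := (hasDerivAt_id _).prodMk (hasDerivAt_const _ _)
    have hpt : ((q.1, y₀.2) : ℝ × EuclideanSpace ℝ (Fin m)) = y₀ := Prod.ext hy1.symm rfl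
    have h2 := HasFDerivAt.comp_hasDerivAt_of_eq q.1 (happ u v) hline hpt.symm
    have h3 := (((hfd.pow 2).mul_const (chartMetric (I := 𝓡 m) gF.inner q.2 y₀.2 u.2 v.2)).sub_const
      (u.1 * v.1))
    have h4 := h2.unique (h3.congr_of_eventuallyEq (Filter.Eventually.of_forall fun s =>
      chartMetric_metric f gF q (y := (s, y₀.2)) (by
        change y₀.2 ∈ _
        rw [hy2]; exact mem_extChartAt_target q.2) u v))
    rw [congrArg (chartMetric (I := 𝓡 m) gF.inner q.2) hy2, chartMetric_self] at h4
    simpa only [ContinuousLinearMap.flip_apply, Nat.cast_ofNat, Nat.add_one_sub_one, pow_one]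
      using h4
  have hinv := (isInvertible_chartMetric_metric (gF := gF) hfq).self_apply_inverse
    (christoffelFirst (metric f gF) q y₀ u v)
  have h5 : chartMetric (metric f gF) q y₀ (christoffel (metric f gF) q y₀ u v) (1, 0) =
      christoffelFirst (metric f gF) q y₀ u v (1, 0) := congrArg (fun L => L (1, 0)) hinv
  rw [hy₀, chartMetric_self] at h5
  have h6 := (metric_apply_time f gF q _).symm.trans h5
  simp only [christoffelFirst, ← hy₀, smul_apply, sub_apply,
    add_apply, ContinuousLinearMap.flip_apply, hconst, htime,
    smul_eq_mul] at h6
  linarith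

end Spacetime

/-! ### The covariant derivative along `ψ` in charts -/

section Submanifold

variable {E : Type*} [NormedAddCommGroup E] [NormedSpace ℝ E]
  {H : Type*} [TopologicalSpace H] {I : ModelWithCorners ℝ E H}
  {N : Type*} [TopologicalSpace N] [ChartedSpace H N]
  {k : ℕ} {M : Type*} [TopologicalSpace M] [ChartedSpace (EuclideanSpace ℝ (Fin k)) M]

variable (I) in
/-- The expression of `ψ` in the preferred charts around `p` and `ψ p`. -/
def localExpr (ψ : M → N) (p : M) : EuclideanSpace ℝ (Fin k) → E :=
  extChartAt I (ψ p) ∘ ψ ∘ (extChartAt (𝓡 k) p).symm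

theorem contDiffAt_localExpr {ψ : M → N} (hψ : ContMDiff (𝓡 k) I ∞ ψ) (p : M) :
    ContDiffAt ℝ ∞ (localExpr I ψ p) (extChartAt (𝓡 k) p p) := by
  have := (contMDiffAt_iff.1 (hψ p)).2
  rwa [ModelWithCorners.range_eq_univ, contDiffWithinAt_univ] at this

variable [IsManifold I ∞ N] [IsManifold (𝓡 k) ∞ M]

/-- The chain rule is needed at all points near `p`, not only at `p`, because the covariant
derivative differentiates the field `dψ(∂_j)`. -/
theorem fderiv_localExpr {ψ : M → N} (hψ : ContMDiff (𝓡 k) I ∞ ψ) (p : M)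
    {y : EuclideanSpace ℝ (Fin k)} (hy : y ∈ (extChartAt (𝓡 k) p).target)
    (hψy : ψ ((extChartAt (𝓡 k) p).symm y) ∈ (chartAt H (ψ p)).source) :
    fderiv ℝ (localExpr I ψ p) y =
      (mfderiv I 𝓘(ℝ, E) (extChartAt I (ψ p)) (ψ ((extChartAt (𝓡 k) p).symm y)) : E →L[ℝ] E).comp
        ((mfderiv (𝓡 k) I ψ ((extChartAt (𝓡 k) p).symm y) :
          EuclideanSpace ℝ (Fin k) →L[ℝ] E).comp
        (mfderiv 𝓘(ℝ, EuclideanSpace ℝ (Fin k)) (𝓡 k) (extChartAt (𝓡 k) p).symm y :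
          EuclideanSpace ℝ (Fin k) →L[ℝ] EuclideanSpace ℝ (Fin k))) := by
  have : IsManifold (𝓡 k) 1 M := IsManifold.of_le (n := ∞) (by simp)
  have : IsManifold I 1 N := IsManifold.of_le (n := ∞) (by simp)
  have h1 := mdifferentiableWithinAt_extChartAt_symm (I := 𝓡 k) hy
  rw [ModelWithCorners.range_eq_univ, mdifferentiableWithinAt_univ] at h1
  have h2 := ((hψ ((extChartAt (𝓡 k) p).symm y)).mdifferentiableAt (by simp)).hasMFDerivAt
  have h3 := (mdifferentiableAt_extChartAt (I := I) hψy).hasMFDerivAt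
  refine HasFDerivAt.fderiv ?_
  exact hasMFDerivAt_iff_hasFDerivAt.1 (h3.comp y (h2.comp y h1.hasMFDerivAt))

theorem coordField_self (p : M) (i : Fin k) :
    (coordField p i p : EuclideanSpace ℝ (Fin k)) = EuclideanSpace.single i 1 := by
  have : IsManifold (𝓡 k) 1 M := IsManifold.of_le (n := ∞) (by simp)
  rw [coordField, mfderiv_extChartAt_symm_self]
  rfl

theorem mfderiv_eq_fderiv_localExpr {ψ : M → N} (hψ : ContMDiff (𝓡 k) I ∞ ψ) (p : M) :
    (mfderiv (𝓡 k) I ψ p : EuclideanSpace ℝ (Fin k) →L[ℝ] E) =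
      fderiv ℝ (localExpr I ψ p) (extChartAt (𝓡 k) p p) := by
  have : IsManifold (𝓡 k) 1 M := IsManifold.of_le (n := ∞) (by simp)
  have : IsManifold I 1 N := IsManifold.of_le (n := ∞) (by simp)
  rw [fderiv_localExpr hψ p (mem_extChartAt_target p) (by simp), mfderiv_extChartAt_symm_self,
    extChartAt_to_inv, mfderiv_extChartAt_self]
  rfl

/-- The components of `dψ(∂_j)` near `p` are the `j`-th partial derivatives of the local expression,
so differentiating them produces its second derivative; the identification of `T_{ψ p} N` with `E`
is the identity. -/
theorem covDerivAlong_coordField (g : TwoTensor I N) {ψ : M → N} (hψ : ContMDiff (𝓡 k) I ∞ ψ)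
    (p : M) (i j : Fin k) :
    (covDerivAlong g ψ (fun p' => mfderiv (𝓡 k) I ψ p' (coordField p j p')) p (coordField p i p)
      : E) =
    fderiv ℝ (fderiv ℝ (localExpr I ψ p)) (extChartAt (𝓡 k) p p) (EuclideanSpace.single i 1)
      (EuclideanSpace.single j 1) +
    christoffel g (ψ p) (extChartAt I (ψ p) (ψ p))
      (fderiv ℝ (localExpr I ψ p) (extChartAt (𝓡 k) p p) (EuclideanSpace.single i 1))
      (fderiv ℝ (localExpr I ψ p) (extChartAt (𝓡 k) p p) (EuclideanSpace.single j 1)) := by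
  have : IsManifold (𝓡 k) 1 M := IsManifold.of_le (n := ∞) (by simp)
  have : IsManifold I 1 N := IsManifold.of_le (n := ∞) (by simp)
  set x₀ := extChartAt (𝓡 k) p p with hx₀
  set D : EuclideanSpace ℝ (Fin k) → E :=
    fun y => fderiv ℝ (localExpr I ψ p) y (EuclideanSpace.single j 1) with hD
  let Vc : M → E := fun p' => mfderiv I 𝓘(ℝ, E) (extChartAt I (ψ p)) (ψ p')
    (mfderiv (𝓡 k) I ψ p' (coordField p j p'))
  have hVc : Vc =ᶠ[nhds p] D ∘ extChartAt (𝓡 k) p := by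
    have h1 : ∀ᶠ p' in nhds p, ψ p' ∈ (chartAt H (ψ p)).source :=
      hψ.continuous.continuousAt.eventually (chart_source_mem_nhds H (ψ p))
    filter_upwards [h1, extChartAt_source_mem_nhds (I := 𝓡 k) p] with p' h2 h3
    have h4 := (extChartAt (𝓡 k) p).left_inv h3
    have h5 := fderiv_localExpr hψ p ((extChartAt (𝓡 k) p).map_source h3) (by rwa [h4])
    rw [h4] at h5
    simp only [hD, Function.comp_apply, h5]
    rfl
  have hDd : HasFDerivAt D
      ((fderiv ℝ (fderiv ℝ (localExpr I ψ p)) x₀).flip (EuclideanSpace.single j 1)) x₀ := by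
    have h1 := ((((contDiffAt_localExpr hψ p).of_le (m := 2) (WithTop.coe_le_coe.2 le_top)).fderiv_right (m := 1) (by norm_num)).differentiableAt
      (by simp)).hasFDerivAt
    refine (h1.clm_apply (hasFDerivAt_const (EuclideanSpace.single j (1 : ℝ)) x₀)).congr_fderiv
      (ContinuousLinearMap.ext fun c => ?_)
    simp [-extChartAt, x₀]
  have hdV : (mfderiv (𝓡 k) 𝓘(ℝ, E) Vc p : EuclideanSpace ℝ (Fin k) →L[ℝ] E) =
      (fderiv ℝ (fderiv ℝ (localExpr I ψ p)) x₀).flip (EuclideanSpace.single j 1) := by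
    rw [hVc.mfderiv_eq]
    have h1 := (mdifferentiableAt_extChartAt (I := 𝓡 k) (mem_chart_source _ p)).hasMFDerivAt
    rw [mfderiv_extChartAt_self] at h1
    exact (hDd.hasMFDerivAt.comp p h1).mfderiv
  let u : Fin k → E := fun i => mfderiv (𝓡 k) I ψ p (coordField p i p)
  have hu : ∀ i, u i = fderiv ℝ (localExpr I ψ p) x₀ (EuclideanSpace.single i 1) := by
    intro i
    simp only [u]
    rw [coordField_self, mfderiv_eq_fderiv_localExpr hψ]
    rfl
  let dV : E := mfderiv (𝓡 k) 𝓘(ℝ, E) Vc p (coordField p i p)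
  have hdV' : dV = fderiv ℝ (fderiv ℝ (localExpr I ψ p)) x₀ (EuclideanSpace.single i 1)
      (EuclideanSpace.single j 1) := by
    simp only [dV]
    rw [hdV, coordField_self]
    rfl
  let A : E →L[ℝ] E := mfderiv I 𝓘(ℝ, E) (extChartAt I (ψ p)) (ψ p)
  have hA : A = ContinuousLinearMap.id ℝ E := mfderiv_extChartAt_self
  have hcov : (covDerivAlong g ψ (fun p' => mfderiv (𝓡 k) I ψ p' (coordField p j p')) p
      (coordField p i p) : E) =
      A.inverse (dV + christoffel g (ψ p) (extChartAt I (ψ p) (ψ p)) (A (u i)) (A (u j))) := rfl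
  rw [hcov, hA, ContinuousLinearMap.inverse_id]
  simp only [ContinuousLinearMap.id_apply]
  rw [hdV', hu, hu]

end Submanifold

/-! ### Mean curvature and the Hessian of the height -/

section MeanCurvature

variable {m : ℕ} {F : Type*} [TopologicalSpace F] [ChartedSpace (EuclideanSpace ℝ (Fin m)) F]
  {k : ℕ} {M : Type*} [TopologicalSpace M] [ChartedSpace (EuclideanSpace ℝ (Fin k)) M]

/-- The height function in the preferred chart around `p`. -/
def localHeight (ψ : M → ℝ × F) (p : M) : EuclideanSpace ℝ (Fin k) → ℝ :=
  height ψ ∘ (extChartAt (𝓡 k) p).symm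

theorem fst_localExpr (ψ : M → ℝ × F) (p : M) (y : EuclideanSpace ℝ (Fin k)) :
    (localExpr (model m) ψ p y).1 = localHeight ψ p y :=
  extChartAt_model_fst (ψ p) _

/-- The Hessian of the height function in the preferred chart around `p`. -/
def heightHessian (ψ : M → ℝ × F) (p : M) : Matrix (Fin k) (Fin k) ℝ :=
  formMatrix (fderiv ℝ (fderiv ℝ (localHeight ψ p)) (extChartAt (𝓡 k) p p))

theorem contDiffAt_localHeight {ψ : M → ℝ × F} (hψ : ContMDiff (𝓡 k) (model m) ∞ ψ) (p : M) :
    ContDiffAt ℝ 2 (localHeight ψ p) (extChartAt (𝓡 k) p p) := by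
  have h := (contDiffAt_localExpr hψ p).of_le (m := 2) (WithTop.coe_le_coe.2 le_top)
  exact (h.fst).congr_of_eventuallyEq (Filter.Eventually.of_forall fun y =>
    (fst_localExpr ψ p y).symm)

theorem fst_fderiv_localExpr {ψ : M → ℝ × F} {p : M} {y : EuclideanSpace ℝ (Fin k)}
    (h : DifferentiableAt ℝ (localExpr (model m) ψ p) y) (v : EuclideanSpace ℝ (Fin k)) :
    (fderiv ℝ (localExpr (model m) ψ p) y v).1 = fderiv ℝ (localHeight ψ p) y v := by
  have h1 : localHeight (k := k) ψ p = fun y => (localExpr (model m) ψ p y).1 :=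
    funext fun y => (fst_localExpr ψ p y).symm
  rw [h1, (HasFDerivAt.fst h.hasFDerivAt).fderiv]
  rfl

theorem fst_fderiv_fderiv_localExpr {ψ : M → ℝ × F} (hψ : ContMDiff (𝓡 k) (model m) ∞ ψ) (p : M)
    (v w : EuclideanSpace ℝ (Fin k)) :
    (fderiv ℝ (fderiv ℝ (localExpr (model m) ψ p)) (extChartAt (𝓡 k) p p) v w).1 =
      fderiv ℝ (fderiv ℝ (localHeight ψ p)) (extChartAt (𝓡 k) p p) v w := by
  have h := (contDiffAt_localExpr hψ p).of_le (m := 2) (WithTop.coe_le_coe.2 le_top)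
  have h1 : fderiv ℝ (localHeight ψ p) =ᶠ[nhds (extChartAt (𝓡 k) p p)] fun y =>
      (ContinuousLinearMap.fst ℝ ℝ (EuclideanSpace ℝ (Fin m))).comp
        (fderiv ℝ (localExpr (model m) ψ p) y) := by
    filter_upwards [h.eventually (by simp)] with y hy
    ext v
    exact (fst_fderiv_localExpr (hy.differentiableAt (by simp)) v).symm
  have h2 := ((h.fderiv_right (m := 1) (by norm_num)).differentiableAt (by simp)).hasFDerivAt
  rw [h1.fderiv_eq, ((hasFDerivAt_const (ContinuousLinearMap.fst ℝ ℝ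
    (EuclideanSpace ℝ (Fin m))) _).clm_comp h2).fderiv]
  simp [-extChartAt]

theorem posSemidef_heightHessian {ψ : M → ℝ × F} (hψ : ContMDiff (𝓡 k) (model m) ∞ ψ) {p : M}
    (h : IsLocalMin (localHeight (k := k) ψ p) (extChartAt (𝓡 k) p p)) :
    (heightHessian (k := k) ψ p).PosSemidef :=
  posSemidef_formMatrix (fun v w => (contDiffAt_localHeight hψ p).isSymmSndFDerivAt (by simp) v w)
    fun v => fderiv_fderiv_nonneg_of_isLocalMin (contDiffAt_localHeight hψ p) h v

theorem posSemidef_neg_heightHessian {ψ : M → ℝ × F} (hψ : ContMDiff (𝓡 k) (model m) ∞ ψ) {p : M}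
    (h : IsLocalMax (localHeight (k := k) ψ p) (extChartAt (𝓡 k) p p)) :
    (-heightHessian (k := k) ψ p).PosSemidef := by
  have hn : ∀ v, fderiv ℝ (fderiv ℝ (localHeight (k := k) ψ p)) (extChartAt (𝓡 k) p p) v v ≤ 0 := by
    intro v
    have h1 := fderiv_fderiv_nonneg_of_isLocalMin (contDiffAt_localHeight hψ p).neg h.neg v
    have h2 : fderiv ℝ (-localHeight (k := k) ψ p) = -fderiv ℝ (localHeight (k := k) ψ p) :=
      funext fun y => fderiv_neg
    have h3 : fderiv ℝ (fun y => -localHeight (k := k) ψ p y) =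
      -fderiv ℝ (localHeight (k := k) ψ p) := h2
    rw [h3, fderiv_neg] at h1
    simpa [-extChartAt] using h1
  have h4 : -heightHessian (k := k) ψ p =
      formMatrix (-fderiv ℝ (fderiv ℝ (localHeight ψ p)) (extChartAt (𝓡 k) p p)) := by
    ext i j
    rfl
  rw [h4]
  refine posSemidef_formMatrix (fun v w => ?_) fun v => ?_
  · exact congrArg Neg.neg ((contDiffAt_localHeight hψ p).isSymmSndFDerivAt (by simp) v w)
  · exact neg_nonneg.2 (hn v)

theorem isLocalMin_localHeight {X : Type*} {ψ : M → ℝ × X} {p : M} (h : IsLocalMin (height ψ) p) :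
    IsLocalMin (localHeight (k := k) ψ p) (extChartAt (𝓡 k) p p) := by
  have hc := (continuousAt_extChartAt_symm (I := 𝓡 k) p).tendsto
  rw [extChartAt_to_inv] at hc
  have := hc.eventually h
  simpa [IsLocalMin, IsMinFilter, localHeight, -extChartAt, extChartAt_to_inv] using this

theorem isLocalMax_localHeight {X : Type*} {ψ : M → ℝ × X} {p : M} (h : IsLocalMax (height ψ) p) :
    IsLocalMax (localHeight (k := k) ψ p) (extChartAt (𝓡 k) p p) := by
  have hc := (continuousAt_extChartAt_symm (I := 𝓡 k) p).tendsto
  rw [extChartAt_to_inv] at hc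
  have := hc.eventually h
  simpa [IsLocalMax, IsMaxFilter, localHeight, -extChartAt, extChartAt_to_inv] using this

variable [IsManifold (𝓡 m) ∞ F] [IsManifold (𝓡 k) ∞ M]
  {f : ℝ → ℝ} {gF : Bundle.ContMDiffRiemannianMetric (𝓡 m) ∞ (EuclideanSpace ℝ (Fin m))
      (fun x : F => TangentSpace (𝓡 m) x)}
  {J : Set ℝ} {ψ : M → ℝ × F}

theorem gram_eq_formMatrix (p : M) : gram k (metric f gF) ψ p =
    formMatrix (inducedMetric k (metric f gF) ψ p : EuclideanSpace ℝ (Fin k) →L[ℝ]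
      EuclideanSpace ℝ (Fin k) →L[ℝ] ℝ) := by
  ext i j
  simp only [gram, formMatrix, Matrix.of_apply]
  rw [coordField_self, coordField_self]
  rfl

theorem posDef_gram (hψ : IsSpacelikeImmersion k J f gF ψ) (p : M) :
    (gram k (metric f gF) ψ p).PosDef := by
  rw [gram_eq_formMatrix]
  refine posDef_formMatrix (fun v w => ?_) (hψ.posDef p)
  refine (metric_apply f gF (ψ p) _ _).trans (Eq.trans ?_ (metric_apply f gF (ψ p) _ _).symm)
  refine congrArg₂ _ (congrArg _ (gF.symm _ _ _)) (mul_comm _ _)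

/-- At a critical point of the height function the second fundamental form, contracted with `∂_t`
(which amounts to minus its time component), is the Hessian of the height plus `f' / f` times the induced metric. -/
theorem neg_fst_secondFundamentalForm (hJ : IsOpen J) (hf : ContDiffOn ℝ ∞ f J)
    (hpos : ∀ t ∈ J, 0 < f t) (hψ : IsSpacelikeImmersion k J f gF ψ) {p : M}
    (hp : fderiv ℝ (localHeight ψ p) (extChartAt (𝓡 k) p p) = 0) (i j : Fin k) :
    -(secondFundamentalForm (metric f gF) ψ (coordField p i) (coordField p j) p :
        ℝ × EuclideanSpace ℝ (Fin m)).1 =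
      heightHessian ψ p i j +
        deriv f (height ψ p) / f (height ψ p) * gram k (metric f gF) ψ p i j := by
  have hd : DifferentiableAt ℝ (localExpr (model m) ψ p) (extChartAt (𝓡 k) p p) :=
    (contDiffAt_localExpr hψ.contMDiff p).differentiableAt (by simp)
  have hfp : f (ψ p).1 ≠ 0 := (hpos _ (hψ.mem p)).ne'
  -- The image of `dψ` is tangent to the fiber. This removes the time component of the tangential
  -- correction and the `-dt²` term of the Gram matrix.
  have hzero : ∀ v, (fderiv ℝ (localExpr (model m) ψ p) (extChartAt (𝓡 k) p p) v).1 = 0 := by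
    intro v
    rw [fst_fderiv_localExpr hd, hp]
    rfl
  let C : ℝ × EuclideanSpace ℝ (Fin m) := covDerivAlong (metric f gF) ψ
    (fun p' => mfderiv (𝓡 k) (model m) ψ p' (coordField p j p')) p (coordField p i p)
  let A : EuclideanSpace ℝ (Fin k) →L[ℝ] ℝ × EuclideanSpace ℝ (Fin m) :=
    mfderiv (𝓡 k) (model m) ψ p
  have hA : A = fderiv ℝ (localExpr (model m) ψ p) (extChartAt (𝓡 k) p p) :=
    mfderiv_eq_fderiv_localExpr hψ.contMDiff p
  let T : EuclideanSpace ℝ (Fin k) := tangentPart k (metric f gF) ψ p C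
  have hII : (secondFundamentalForm (metric f gF) ψ (coordField p i) (coordField p j) p :
      ℝ × EuclideanSpace ℝ (Fin m)) = -(C - A T) := rfl
  have hC : C = _ := covDerivAlong_coordField (metric f gF) hψ.contMDiff p i j
  have hgram : gram k (metric f gF) ψ p i j = f (ψ p).1 ^ 2 * (gF.inner (ψ p).2 :
      EuclideanSpace ℝ (Fin m) →L[ℝ] EuclideanSpace ℝ (Fin m) →L[ℝ] ℝ)
        (A (EuclideanSpace.single i 1)).2 (A (EuclideanSpace.single j 1)).2 := by
    rw [gram_eq_formMatrix]
    refine (metric_apply f gF (ψ p) (A (EuclideanSpace.single i 1))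
      (A (EuclideanSpace.single j 1))).trans ?_
    rw [hA, hzero, hzero, mul_zero, sub_zero]
  rw [hII, hgram]
  simp only [Prod.fst_neg, Prod.fst_sub, neg_neg]
  rw [hA, hzero, sub_zero, hC, Prod.fst_add, fst_fderiv_fderiv_localExpr hψ.contMDiff,
    christoffel_metric_fst hJ hf (hψ.mem p) hfp]
  -- What remains is `f f' g_F = (f'/f) (f² g_F)`, valid since `f ≠ 0`.
  refine congrArg₂ _ rfl ?_
  simp only [height]
  field_simp

/-- This is the trace of `neg_fst_secondFundamentalForm`: the multiple of the induced metric
contributes `k f'/f`, since `g^{ij} g_{ij} = k`, and the factor `1/k` cancels. -/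
theorem metric_meanCurvature_partialT (hJ : IsOpen J) (hf : ContDiffOn ℝ ∞ f J)
    (hpos : ∀ t ∈ J, 0 < f t) (hk : 1 ≤ k) (hψ : IsSpacelikeImmersion k J f gF ψ) {p : M}
    (hp : fderiv ℝ (localHeight ψ p) (extChartAt (𝓡 k) p p) = 0) :
    metric f gF (ψ p) (meanCurvature k (metric f gF) ψ p) (partialT (ψ p)) =
      (1 / (k : ℝ)) * (∑ i, ∑ j, (gram k (metric f gF) ψ p)⁻¹ i j * heightHessian ψ p i j) +
        deriv f (height ψ p) / f (height ψ p) := by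
  have hk' : (k : ℝ) ≠ 0 := by positivity
  let S : Fin k → Fin k → ℝ × EuclideanSpace ℝ (Fin m) := fun i j =>
    secondFundamentalForm (metric f gF) ψ (coordField p i) (coordField p j) p
  have hS : ∀ i j, -(S i j).1 = heightHessian ψ p i j +
        deriv f (height ψ p) / f (height ψ p) * gram k (metric f gF) ψ p i j :=
    neg_fst_secondFundamentalForm hJ hf hpos hψ hp
  refine (metric_apply_time f gF (ψ p) ((1 / (k : ℝ)) • ∑ i : Fin k, ∑ j : Fin k,
    (gram k (metric f gF) ψ p)⁻¹ i j • S i j)).trans ?_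
  have h1 : -((1 / (k : ℝ)) • ∑ i : Fin k, ∑ j : Fin k,
      (gram k (metric f gF) ψ p)⁻¹ i j • S i j).1 =
      (1 / (k : ℝ)) * ∑ i, ∑ j, (gram k (metric f gF) ψ p)⁻¹ i j * -(S i j).1 := by
    simp [Prod.fst_sum, Finset.sum_neg_distrib]
  rw [h1]
  simp only [hS, mul_add, Finset.sum_add_distrib]
  have h2 : ∑ i, ∑ j, (gram k (metric f gF) ψ p)⁻¹ i j *
      (deriv f (height ψ p) / f (height ψ p) * gram k (metric f gF) ψ p i j) =
      deriv f (height ψ p) / f (height ψ p) * k := by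
    rw [← sum_inv_mul_self (posDef_gram hψ p), Finset.mul_sum]
    refine Finset.sum_congr rfl fun i _ => ?_
    rw [Finset.mul_sum]
    exact Finset.sum_congr rfl fun j _ => by ring
  rw [h2]
  field_simp

/-- At a local minimum of the height function, `g(H, ∂_t) ≥ f' / f`. -/
theorem le_metric_meanCurvature_of_isLocalMin (hJ : IsOpen J) (hf : ContDiffOn ℝ ∞ f J)
    (hpos : ∀ t ∈ J, 0 < f t) (hk : 1 ≤ k) (hψ : IsSpacelikeImmersion k J f gF ψ) {p : M}
    (h : IsLocalMin (height ψ) p) :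
    deriv f (height ψ p) / f (height ψ p) ≤
      metric f gF (ψ p) (meanCurvature k (metric f gF) ψ p) (partialT (ψ p)) := by
  have h1 := isLocalMin_localHeight (k := k) h
  rw [metric_meanCurvature_partialT hJ hf hpos hk hψ h1.fderiv_eq_zero]
  have h2 := sum_inv_mul_nonneg (posDef_gram hψ p) (posSemidef_heightHessian hψ.contMDiff h1)
  have : 0 ≤ (1 / (k : ℝ)) := by positivity
  nlinarith [mul_nonneg this h2]

/-- At a local maximum of the height function, `g(H, ∂_t) ≤ f' / f`. -/
theorem metric_meanCurvature_le_of_isLocalMax (hJ : IsOpen J) (hf : ContDiffOn ℝ ∞ f J)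
    (hpos : ∀ t ∈ J, 0 < f t) (hk : 1 ≤ k) (hψ : IsSpacelikeImmersion k J f gF ψ) {p : M}
    (h : IsLocalMax (height ψ) p) :
    metric f gF (ψ p) (meanCurvature k (metric f gF) ψ p) (partialT (ψ p)) ≤
      deriv f (height ψ p) / f (height ψ p) := by
  have h1 := isLocalMax_localHeight (k := k) h
  rw [metric_meanCurvature_partialT hJ hf hpos hk hψ h1.fderiv_eq_zero]
  have h2 := sum_inv_mul_nonneg (posDef_gram hψ p) (posSemidef_neg_heightHessian hψ.contMDiff h1)
  simp only [Matrix.neg_apply, mul_neg, Finset.sum_neg_distrib] at h2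
  have : 0 ≤ (1 / (k : ℝ)) := by positivity
  nlinarith [mul_nonneg this h2]

end MeanCurvature

end GRW

end

/-! ### The four sign cases -/

open scoped Manifold ContDiff in
theorem theorem4p1
    -- the fiber: a connected Riemannian manifold of dimension `m = n - 1 ≥ 2`
    {m : ℕ} (hm : 2 ≤ m)
    {F : Type*} [TopologicalSpace F] [T2Space F] [SecondCountableTopology F] [ConnectedSpace F]
    [ChartedSpace (EuclideanSpace ℝ (Fin m)) F] [IsManifold (𝓡 m) ∞ F]
    (gF : Bundle.ContMDiffRiemannianMetric (𝓡 m) ∞ (EuclideanSpace ℝ (Fin m))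
      (fun x : F => TangentSpace (𝓡 m) x))
    -- the open interval and the warping function
    (J : Set ℝ) (hJo : IsOpen J) (hJc : J.OrdConnected)
    (f : ℝ → ℝ) (hf : ContDiffOn ℝ ∞ f J) (hfpos : ∀ t ∈ J, 0 < f t)
    -- the connected spacelike submanifold, of dimension `k ≥ 1`
    {k : ℕ} (hk : 1 ≤ k)
    {M : Type*} [TopologicalSpace M] [T2Space M] [SecondCountableTopology M] [ConnectedSpace M]
    [ChartedSpace (EuclideanSpace ℝ (Fin k)) M] [IsManifold (𝓡 k) ∞ M]
    (ψ : M → ℝ × F) (hψ : GRW.IsSpacelikeImmersion k J f gF ψ) :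
    (((∀ p, GRW.metric f gF (ψ p) (GRW.meanCurvature k (GRW.metric f gF) ψ p) (GRW.partialT (ψ p)) < 0) →
        (∀ t ∈ J, 0 ≤ deriv f t) → ∀ p, ¬ IsLocalMin (GRW.height ψ) p) ∧
      ((∀ p, GRW.metric f gF (ψ p) (GRW.meanCurvature k (GRW.metric f gF) ψ p) (GRW.partialT (ψ p)) ≤ 0) →
        (∀ t ∈ J, 0 < deriv f t) → ∀ p, ¬ IsLocalMin (GRW.height ψ) p)) ∧
    (((∀ p, 0 < GRW.metric f gF (ψ p) (GRW.meanCurvature k (GRW.metric f gF) ψ p) (GRW.partialT (ψ p))) →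
        (∀ t ∈ J, deriv f t ≤ 0) → ∀ p, ¬ IsLocalMax (GRW.height ψ) p) ∧
      ((∀ p, 0 ≤ GRW.metric f gF (ψ p) (GRW.meanCurvature k (GRW.metric f gF) ψ p) (GRW.partialT (ψ p))) →
        (∀ t ∈ J, deriv f t < 0) → ∀ p, ¬ IsLocalMax (GRW.height ψ) p)) := by
  have hmin : ∀ p, IsLocalMin (GRW.height ψ) p → _ := fun p h =>
    GRW.le_metric_meanCurvature_of_isLocalMin hJo hf hfpos hk hψ h
  have hmax : ∀ p, IsLocalMax (GRW.height ψ) p → _ := fun p h =>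
    GRW.metric_meanCurvature_le_of_isLocalMax hJo hf hfpos hk hψ h
  refine ⟨⟨fun hH hd p h => ?_, fun hH hd p h => ?_⟩, fun hH hd p h => ?_, fun hH hd p h => ?_⟩
  -- The height lies in `J`, where `f > 0`, so `f'/f` inherits the sign of `f'` and contradicts the
  -- bound at the extremum.
  · exact absurd ((hmin p h).trans_lt (hH p))
      (not_lt.2 (div_nonneg (hd _ (hψ.mem p)) (hfpos _ (hψ.mem p)).le))
  · exact absurd ((hmin p h).trans (hH p))
      (not_le.2 (div_pos (hd _ (hψ.mem p)) (hfpos _ (hψ.mem p))))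
  · exact absurd ((hH p).trans_le (hmax p h))
      (not_lt.2 (div_nonpos_of_nonpos_of_nonneg (hd _ (hψ.mem p)) (hfpos _ (hψ.mem p)).le))
  · exact absurd ((hH p).trans (hmax p h))
      (not_le.2 (div_neg_of_neg_of_pos (hd _ (hψ.mem p)) (hfpos _ (hψ.mem p))))
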